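/- Let $M$ be a smooth $m$-dimensional manifold and $\phi:M\to\mathbb S^n\subset\mathbb R^{n+1}$ a smooth immersion into the unit Euclidean sphere, with $M$ carrying the induced metric $g$ (for instance, $M$ a submanifold of $\mathbb S^n$ and $\phi$ the inclusion). Let $B$ be the second fundamental form of $M$ in $\mathbb S^n$, let $H=\frac1m\operatorname{trace}B$ be the mean curvature vector field, let $A_H$ be the Weingarten operator, $\langle A_H u,v\rangle=\langle B(u,v),H\rangle$, and let $\tau(\phi)=\operatorname{trace}\nabla d\phi=mH$ be the tension field. Assume that (a) $M$ is proper biharmonic: the bitension field $$\tau_2(\phi)=-\Delta\tau(\phi)-\operatorname{trace}R^{\mathbb S^n}(d\phi\,\cdot,\tau(\phi))\,d\phi\,\cdot$$ vanishes identically, where $\Delta=-\operatorname{trace}\nabla^2$ on sections of $\phi^{-1}T\mathbb S^n$ and $R(X,Y)=[\nabla_X,\nabla_Y]-\nabla_{[X,Y]}$, while $\tau(\phi)$ is not identically zero; (b) $M$ has parallel mean curvature vector field: $\nabla^\perp H=0$ in the normal bundle of $M$ in $\mathbb S^n$. Let $p\in M$ be arbitrary, let $\{e_i\}_{i=1}^m$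 be an orthonormal basis of $T_pM$ consisting of eigenvectors of $A_H$, and let $\{a_i\}_{i=1}^m$ be the corresponding eigenvalues, $A_He_i=a_ie_i$. For $i\ne j$ let $K_{ij}$ be the sectional curvature of $(M,g)$ on the plane generated by $e_i$ and $e_j$, and put $K_{ii}=0$. Then, at $p$, (i) $\displaystyle m|H|^2=\sum_{i=1}^m a_i=\sum_{i=1}^m (a_i)^2$; (ii) $\displaystyle (2m-1)\,m|H|^2=\frac12\sum_{i,j=1}^m (a_i+a_j)\bigl(K_{ij}+|B(e_i,e_j)|^2\bigr)$; (iii) $\displaystyle (m-1+m|H|^2)\,m|H|^2=\sum_{i,j=1}^m a_ia_j\bigl(K_{ij}+|B(e_i,e_j)|^2\bigr)$. -/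

import Mathlib

open scoped Manifold ContDiff

noncomputable section

namespace SphereSubmanifold

/-! ### The unit sphere

The Levi-Civita connection of the unit sphere is the tangential projection of the flat derivative
of the ambient Euclidean space. -/

section Sphere

variable {n : ℕ}

/-- For a unit vector `y`, the orthogonal projection onto the tangent space `y^⊥` of the unit
sphere at `y`. -/
def sphereProj (y z : EuclideanSpace ℝ (Fin (n + 1))) : EuclideanSpace ℝ (Fin (n + 1)) :=
  z - inner ℝ z y • y

/-- The covariant derivative `∇_V W` of the unit sphere, where `V` and `W` are vector fields on the
ambient space that are tangent to the sphere along the sphere. -/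
def sphereConn (V W : EuclideanSpace ℝ (Fin (n + 1)) → EuclideanSpace ℝ (Fin (n + 1)))
    (y : EuclideanSpace ℝ (Fin (n + 1))) : EuclideanSpace ℝ (Fin (n + 1)) :=
  sphereProj y (fderiv ℝ W y (V y))

/-- The curvature tensor `R(u, v) w = ∇_u ∇_v w - ∇_v ∇_u w - ∇_[u, v] w` of the unit sphere at
`y`, for `u`, `v`, `w` tangent to the sphere at `y`. The tangent vector `u` is extended to the
tangent field `z ↦ sphereProj z u`, and `v` and `w` likewise. -/
def sphereCurvature (y u v w : EuclideanSpace ℝ (Fin (n + 1))) : EuclideanSpace ℝ (Fin (n + 1)) :=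
  let U := fun z => sphereProj z u
  let V := fun z => sphereProj z v
  let W := fun z => sphereProj z w
  sphereConn U (sphereConn V W) y - sphereConn V (sphereConn U W) y
    - sphereConn (VectorField.lieBracket ℝ U V) W y

end Sphere

/-! ### Immersions into the unit sphere in local coordinates

Here `X` is a local parametrization: a map from (an open subset of) `ℝ^m` to `ℝ^(n+1)` with values
in the unit sphere. Fields along `X` are maps from `ℝ^m` to `ℝ^(n+1)`. -/

section Local

variable {m n : ℕ}

/-- The partial derivative `∂_i f`. -/
def pd {G : Type*} [NormedAddCommGroup G] [NormedSpace ℝ G] (i : Fin m)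
    (f : EuclideanSpace ℝ (Fin m) → G) (x : EuclideanSpace ℝ (Fin m)) : G :=
  fderiv ℝ f x (EuclideanSpace.single i 1)

variable (X : EuclideanSpace ℝ (Fin m) → EuclideanSpace ℝ (Fin (n + 1)))

/-- The matrix `g_ij = ⟨∂_i X, ∂_j X⟩` of the induced metric. -/
def metric (x : EuclideanSpace ℝ (Fin m)) : Matrix (Fin m) (Fin m) ℝ :=
  Matrix.of fun i j => inner ℝ (pd i X x) (pd j X x)

/-- The Christoffel symbol `Γ^k_ij` of the induced metric. -/
def christoffel (i j k : Fin m) (x : EuclideanSpace ℝ (Fin m)) : ℝ :=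
  (1 / 2) * ∑ l, (metric X x)⁻¹ k l *
    (pd i (fun y => metric X y j l) x + pd j (fun y => metric X y i l) x
      - pd l (fun y => metric X y i j) x)

/-- The component of `∂_l` in `R(∂_i, ∂_j) ∂_k`, where `R` is the curvature tensor of the induced
metric with the sign convention `R(u, v) w = ∇_u ∇_v w - ∇_v ∇_u w - ∇_[u, v] w`. -/
def riemann (i j k l : Fin m) (x : EuclideanSpace ℝ (Fin m)) : ℝ :=
  pd i (christoffel X j k l) x - pd j (christoffel X i k l) x
    + ∑ s, (christoffel X j k s x * christoffel X i s l x
      - christoffel X i k s x * christoffel X j s l x)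

/-- The inner product `g(u, v)` of tangent vectors with components `u^i` and `v^j`. -/
def metricForm (x u v : EuclideanSpace ℝ (Fin m)) : ℝ :=
  ∑ i, ∑ j, metric X x i j * u i * v j

/-- The vector `R(u, v) w`. -/
def curvatureVec (x u v w : EuclideanSpace ℝ (Fin m)) : EuclideanSpace ℝ (Fin m) :=
  WithLp.toLp 2 fun l => ∑ i, ∑ j, ∑ k, riemann X i j k l x * u i * v j * w k

/-- The sectional curvature of the induced metric on the plane generated by the linearly
independent vectors `u` and `v`. -/
def sectional (x u v : EuclideanSpace ℝ (Fin m)) : ℝ :=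
  metricForm X x (curvatureVec X x u v v) u /
    (metricForm X x u u * metricForm X x v v - metricForm X x u v ^ 2)

/-- The derivative `∇_{∂_i} V` of a field `V` along `X`, for the pull-back of the Levi-Civita
connection of the unit sphere. -/
def covDeriv (i : Fin m) (V : EuclideanSpace ℝ (Fin m) → EuclideanSpace ℝ (Fin (n + 1)))
    (x : EuclideanSpace ℝ (Fin m)) : EuclideanSpace ℝ (Fin (n + 1)) :=
  sphereProj (X x) (pd i V x)

/-- The second fundamental form
`B(∂_i, ∂_j) = ∇_{∂_i} ∂_j X - (∇^M_{∂_i} ∂_j) X`. -/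
def secondForm (i j : Fin m) (x : EuclideanSpace ℝ (Fin m)) : EuclideanSpace ℝ (Fin (n + 1)) :=
  covDeriv X i (pd j X) x - ∑ k, christoffel X i j k x • pd k X x

/-- The second fundamental form `B(u, v)`. -/
def secondFormVec (x u v : EuclideanSpace ℝ (Fin m)) : EuclideanSpace ℝ (Fin (n + 1)) :=
  ∑ i, ∑ j, (u i * v j) • secondForm X i j x

/-- The tension field: the trace of `∇ dX` with respect to the induced metric. -/
def tension (x : EuclideanSpace ℝ (Fin m)) : EuclideanSpace ℝ (Fin (n + 1)) :=
  ∑ i, ∑ j, (metric X x)⁻¹ i j • secondForm X i j x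

/-- The mean curvature vector field `H = (1 / m) trace B`. -/
def meanCurvature (x : EuclideanSpace ℝ (Fin m)) : EuclideanSpace ℝ (Fin (n + 1)) :=
  (1 / (m : ℝ)) • ∑ i, ∑ j, (metric X x)⁻¹ i j • secondForm X i j x

/-- The Weingarten operator `A_ξ`, i.e. the operator with `g(A_ξ u, v) = ⟨B(u, v), ξ⟩`, in
components. -/
def weingarten (x : EuclideanSpace ℝ (Fin m)) (ξ : EuclideanSpace ℝ (Fin (n + 1))) :
    EuclideanSpace ℝ (Fin m) →ₗ[ℝ] EuclideanSpace ℝ (Fin m) :=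
  Matrix.toEuclideanLin
    ((metric X x)⁻¹ * Matrix.of fun i j => inner ℝ (secondForm X i j x) ξ)

/-- The component orthogonal to the image of `dX` of an ambient vector. -/
def normalPart (x : EuclideanSpace ℝ (Fin m)) (w : EuclideanSpace ℝ (Fin (n + 1))) :
    EuclideanSpace ℝ (Fin (n + 1)) :=
  w - ∑ i, ∑ j, ((metric X x)⁻¹ i j * inner ℝ w (pd i X x)) • pd j X x

/-- The derivative `∇^⊥_{∂_i} ξ` of a normal field `ξ` in the normal bundle of `X` in the
sphere. -/
def normalDeriv (i : Fin m) (ξ : EuclideanSpace ℝ (Fin m) → EuclideanSpace ℝ (Fin (n + 1)))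
    (x : EuclideanSpace ℝ (Fin m)) : EuclideanSpace ℝ (Fin (n + 1)) :=
  normalPart X x (covDeriv X i ξ x)

/-- The rough Laplacian `Δ V = - trace ∇² V` on fields along `X`, with the sign that makes it a
nonnegative operator. -/
def roughLaplacian (V : EuclideanSpace ℝ (Fin m) → EuclideanSpace ℝ (Fin (n + 1)))
    (x : EuclideanSpace ℝ (Fin m)) : EuclideanSpace ℝ (Fin (n + 1)) :=
  - ∑ i, ∑ j, (metric X x)⁻¹ i j •
      (covDeriv X i (covDeriv X j V) x - ∑ k, christoffel X i j k x • covDeriv X k V x)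

/-- The bitension field `τ₂ = - Δ τ - trace R(dX ·, τ) dX ·`, where `R` is the curvature tensor of
the unit sphere. -/
def bitension (x : EuclideanSpace ℝ (Fin m)) : EuclideanSpace ℝ (Fin (n + 1)) :=
  - roughLaplacian X (tension X) x
    - ∑ i, ∑ j, (metric X x)⁻¹ i j •
        sphereCurvature (X x) (pd i X x) (tension X x) (pd j X x)

end Local

/-! ### Immersed submanifolds of the unit sphere -/

section Global

variable (m : ℕ) {n : ℕ} {M : Type*} [TopologicalSpace M] [ChartedSpace (EuclideanSpace ℝ (Fin m)) M]
  (φ : M → Metric.sphere (0 : EuclideanSpace ℝ (Fin (n + 1))) 1)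

/-- `φ` is a smooth immersion into the unit sphere. -/
def IsSmoothImmersion : Prop :=
  ContMDiff (𝓡 m) (𝓡 n) ∞ φ ∧ ∀ p, Function.Injective (mfderiv (𝓡 m) (𝓡 n) φ p)

/-- The expression of `φ` in the chart `c`, with values in the ambient Euclidean space. -/
def localRep (c : OpenPartialHomeomorph M (EuclideanSpace ℝ (Fin m)))
    (x : EuclideanSpace ℝ (Fin m)) : EuclideanSpace ℝ (Fin (n + 1)) :=
  (φ (c.symm x) : EuclideanSpace ℝ (Fin (n + 1)))

/-- `φ` is harmonic for the induced metric (equivalently, minimal): `τ = 0` everywhere. -/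
def IsHarmonic : Prop :=
  ∀ c ∈ atlas (EuclideanSpace ℝ (Fin m)) M, ∀ x ∈ c.target, tension (localRep m φ c) x = 0

/-- `φ` is biharmonic for the induced metric: `τ₂ = 0` everywhere. -/
def IsBiharmonic : Prop :=
  ∀ c ∈ atlas (EuclideanSpace ℝ (Fin m)) M, ∀ x ∈ c.target, bitension (localRep m φ c) x = 0

/-- `φ` is proper biharmonic: biharmonic and not harmonic. -/
def IsProperBiharmonic : Prop :=
  IsBiharmonic m φ ∧ ¬ IsHarmonic m φ

/-- The mean curvature vector field is parallel in the normal bundle: `∇^⊥ H = 0` everywhere. -/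
def HasParallelMeanCurvature : Prop :=
  ∀ c ∈ atlas (EuclideanSpace ℝ (Fin m)) M, ∀ x ∈ c.target, ∀ i,
    normalDeriv (localRep m φ c) i (meanCurvature (localRep m φ c)) x = 0

/-! The pointwise objects at `p`. They are computed in the preferred chart at `p`, for which the
components of a vector of `TangentSpace (𝓡 m) p` are its coordinates. -/

variable (p : M)

/-- The induced metric at `p`. -/
def inducedMetricAt (u v : TangentSpace (𝓡 m) p) : ℝ :=
  metricForm (localRep m φ (chartAt (EuclideanSpace ℝ (Fin m)) p))
    (chartAt (EuclideanSpace ℝ (Fin m)) p p) u v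

/-- The mean curvature vector `H` at `p`. -/
def meanCurvatureAt : EuclideanSpace ℝ (Fin (n + 1)) :=
  meanCurvature (localRep m φ (chartAt (EuclideanSpace ℝ (Fin m)) p))
    (chartAt (EuclideanSpace ℝ (Fin m)) p p)

/-- The second fundamental form `B` at `p`. -/
def secondFormAt (u v : TangentSpace (𝓡 m) p) : EuclideanSpace ℝ (Fin (n + 1)) :=
  secondFormVec (localRep m φ (chartAt (EuclideanSpace ℝ (Fin m)) p))
    (chartAt (EuclideanSpace ℝ (Fin m)) p p) u v

/-- The Weingarten operator `A_ξ` at `p`. -/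
def weingartenAt (ξ : EuclideanSpace ℝ (Fin (n + 1))) :
    TangentSpace (𝓡 m) p →ₗ[ℝ] TangentSpace (𝓡 m) p :=
  weingarten (localRep m φ (chartAt (EuclideanSpace ℝ (Fin m)) p))
    (chartAt (EuclideanSpace ℝ (Fin m)) p p) ξ

/-- The sectional curvature at `p` of the plane generated by `u` and `v`. -/
def sectionalAt (u v : TangentSpace (𝓡 m) p) : ℝ :=
  sectional (localRep m φ (chartAt (EuclideanSpace ℝ (Fin m)) p))
    (chartAt (EuclideanSpace ℝ (Fin m)) p p) u v

end Global

end SphereSubmanifold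

end

/-! Everything is done at one point of one chart. Two expansions of `mH` carry the proof. The first
is the definition: `mH = ∑ B(e_p, e_p)`. The second is the normal part of the biharmonic equation:
for a parallel normal field `ξ`, the Weingarten formula `∇ξ = -A_ξ` shows that `Δξ` has normal part
`trace B(A_ξ ·, ·)`, while constant curvature one turns `τ₂ = 0` into `Δτ = mτ`. Hence `∑ a_p B(e_p,
e_p) = mH` in an eigenframe (`sum_smul_secondForm_eq_tension`, `sum_smul_secondFormVec_eigenframe`).

Pairing both expansions with `H`, where `⟨B(e_i, e_j), H⟩ = a_i δ_ij`, gives (i). For (ii) and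
(iii), the Gauss equation reads `K_ij + |B(e_i, e_j)|² = ⟨B(e_i, e_i), B(e_j, e_j)⟩ + 1 - δ_ij`.
Weighting the inner products by `a_i`, `a_j` or `a_i a_j` and summing always gives `|mH|²`, because
each factor sums to `mH` with or without its weight. The rest is (i). -/

namespace SphereSubmanifold

open Filter Topology

/-! ### Partial derivatives of functions on Euclidean space. -/

section Calculus

variable {m : ℕ} {F G : Type*} [NormedAddCommGroup F] [NormedSpace ℝ F]
  [NormedAddCommGroup G] [InnerProductSpace ℝ G] {x : EuclideanSpace ℝ (Fin m)}
  {U : Set (EuclideanSpace ℝ (Fin m))}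

theorem pd_congr (i : Fin m) {f g : EuclideanSpace ℝ (Fin m) → F} (hU : IsOpen U) (hx : x ∈ U)
    (h : ∀ y ∈ U, f y = g y) : pd i f x = pd i g x := by
  have : f =ᶠ[𝓝 x] g := by
    filter_upwards [hU.mem_nhds hx] with y hy using h y hy
  simp only [pd, this.fderiv_eq]

theorem pd_const (i : Fin m) (c : F) : pd i (fun _ => c) x = 0 := by
  simp [pd]

theorem pd_inner (i : Fin m) {f g : EuclideanSpace ℝ (Fin m) → G} (hf : DifferentiableAt ℝ f x)
    (hg : DifferentiableAt ℝ g x) :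
    pd i (fun y => inner ℝ (f y) (g y)) x
      = inner ℝ (f x) (pd i g x) + inner ℝ (pd i f x) (g x) := by
  simp only [pd, fderiv_inner_apply ℝ hf hg]

theorem pd_sum (i : Fin m) {ι : Type*} (s : Finset ι) {f : ι → EuclideanSpace ℝ (Fin m) → F}
    (hf : ∀ k ∈ s, DifferentiableAt ℝ (f k) x) :
    pd i (fun y => ∑ k ∈ s, f k y) x = ∑ k ∈ s, pd i (f k) x := by
  simp only [pd, fderiv_fun_sum hf, sum_apply]

theorem pd_smul (i : Fin m) {s : EuclideanSpace ℝ (Fin m) → ℝ} {f : EuclideanSpace ℝ (Fin m) → F}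
    (hs : DifferentiableAt ℝ s x) (hf : DifferentiableAt ℝ f x) :
    pd i (fun y => s y • f y) x = s x • pd i f x + pd i s x • f x := by
  simp [pd, fderiv_fun_smul hs hf]

theorem pd_mul (i : Fin m) {s t : EuclideanSpace ℝ (Fin m) → ℝ}
    (hs : DifferentiableAt ℝ s x) (ht : DifferentiableAt ℝ t x) :
    pd i (fun y => s y * t y) x = s x * pd i t x + pd i s x * t x :=
  pd_smul i hs ht

theorem pd_const_smul (i : Fin m) (c : ℝ) (f : EuclideanSpace ℝ (Fin m) → F) :
    pd i (fun y => c • f y) x = c • pd i f x := by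
  simp only [pd, ← Pi.smul_def, fderiv_const_smul_field]
  rfl

theorem contDiffOn_pd (i : Fin m) {f : EuclideanSpace ℝ (Fin m) → F} (hU : IsOpen U)
    (hf : ContDiffOn ℝ ∞ f U) : ContDiffOn ℝ ∞ (pd i f) U :=
  (hf.fderiv_of_isOpen hU (m := ∞) (by simp)).clm_apply contDiffOn_const

theorem pd_comm (i j : Fin m) {f : EuclideanSpace ℝ (Fin m) → F} (hU : IsOpen U) (hx : x ∈ U)
    (hf : ContDiffOn ℝ ∞ f U) : pd i (pd j f) x = pd j (pd i f) x := by
  have hc : ContDiffAt ℝ ∞ f x := hf.contDiffAt (hU.mem_nhds hx)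
  have hs : IsSymmSndFDerivAt ℝ f x :=
    hc.isSymmSndFDerivAt (by
      rw [minSmoothness_of_isRCLikeNormedField]
      exact WithTop.coe_le_coe.2 (le_top : (2 : ℕ∞) ≤ ⊤))
  have hd : DifferentiableAt ℝ (fderiv ℝ f) x :=
    (hc.fderiv_right (m := 1) (by norm_cast)).differentiableAt one_ne_zero
  have key : ∀ k l : Fin m, pd k (pd l f) x
      = fderiv ℝ (fderiv ℝ f) x (EuclideanSpace.single k 1) (EuclideanSpace.single l 1) := by
    intro k l
    have := fderiv_clm_apply hd (differentiableAt_const (EuclideanSpace.single l (1 : ℝ)))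
    simp only [pd]
    rw [show (pd l f) = fun y => fderiv ℝ f y (EuclideanSpace.single l 1) from rfl, this]
    simp
  rw [key, key]
  exact hs _ _

end Calculus

/-- `X` is a smooth immersion of the open set `U` into the unit sphere. -/
structure IsLocalImmersion {m n : ℕ} (X : EuclideanSpace ℝ (Fin m) → EuclideanSpace ℝ (Fin (n + 1)))
    (U : Set (EuclideanSpace ℝ (Fin m))) : Prop where
  isOpen : IsOpen U
  contDiffOn : ContDiffOn ℝ ∞ X U
  inner_self : ∀ x ∈ U, inner ℝ (X x) (X x) = (1 : ℝ)
  linearIndependent : ∀ x ∈ U, LinearIndependent ℝ fun i => pd i X x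

theorem inner_sphereProj_of_orthogonal {n : ℕ} {y z ν : EuclideanSpace ℝ (Fin (n + 1))}
    (h : inner ℝ y ν = (0 : ℝ)) : inner ℝ (sphereProj y z) ν = inner ℝ z ν := by
  simp [sphereProj, inner_sub_left, real_inner_smul_left, h]

theorem inner_sphereProj_self {n : ℕ} {y z : EuclideanSpace ℝ (Fin (n + 1))}
    (h : inner ℝ y y = (1 : ℝ)) : inner ℝ (sphereProj y z) y = (0 : ℝ) := by
  rw [sphereProj, inner_sub_left, real_inner_smul_left, h, mul_one, sub_self]

/-! ### Induced metric, Christoffel symbols and second fundamental form. -/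

section Metric

variable {m n : ℕ} (X : EuclideanSpace ℝ (Fin m) → EuclideanSpace ℝ (Fin (n + 1)))
  (x : EuclideanSpace ℝ (Fin m))

theorem metric_comm (i j : Fin m) : metric X x i j = metric X x j i := by
  simp only [metric, Matrix.of_apply, real_inner_comm]

theorem metric_inv_comm (i j : Fin m) : (metric X x)⁻¹ i j = (metric X x)⁻¹ j i := by
  have : (metric X x).transpose = metric X x := by ext i j; exact metric_comm X x j i
  conv_lhs => rw [← this, ← Matrix.transpose_nonsing_inv]
  rfl

end Metric

namespace IsLocalImmersion

variable {m n : ℕ} {X : EuclideanSpace ℝ (Fin m) → EuclideanSpace ℝ (Fin (n + 1))}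
  {U : Set (EuclideanSpace ℝ (Fin m))} {x : EuclideanSpace ℝ (Fin m)}

theorem differentiableAt (h : IsLocalImmersion X U) {F : Type*} [NormedAddCommGroup F]
    [NormedSpace ℝ F]
    {f : EuclideanSpace ℝ (Fin m) → F} (hf : ContDiffOn ℝ ∞ f U) (hx : x ∈ U) :
    DifferentiableAt ℝ f x :=
  (hf.contDiffAt (h.isOpen.mem_nhds hx)).differentiableAt (by simp)

theorem contDiffOn_pd (h : IsLocalImmersion X U) (i : Fin m) : ContDiffOn ℝ ∞ (pd i X) U :=
  SphereSubmanifold.contDiffOn_pd i h.isOpen h.contDiffOn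

theorem contDiffOn_pd_pd (h : IsLocalImmersion X U) (i j : Fin m) :
    ContDiffOn ℝ ∞ (pd i (pd j X)) U :=
  SphereSubmanifold.contDiffOn_pd i h.isOpen (h.contDiffOn_pd j)

theorem isUnit_det_metric (h : IsLocalImmersion X U) (hx : x ∈ U) : IsUnit (metric X x).det := by
  have := (h.linearIndependent x hx)
  have hp : (Matrix.gram ℝ fun i => pd i X x).PosDef := Matrix.posDef_gram_of_linearIndependent this
  have he : metric X x = Matrix.gram ℝ fun i => pd i X x := by
    ext i j; simp [metric, Matrix.gram]
  rw [he]
  exact hp.det_pos.ne'.isUnit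

theorem contDiffOn_metric (h : IsLocalImmersion X U) (i j : Fin m) :
    ContDiffOn ℝ ∞ (fun y => metric X y i j) U :=
  (h.contDiffOn_pd i).inner ℝ (h.contDiffOn_pd j)

theorem contDiffOn_metric_inv (h : IsLocalImmersion X U) (i j : Fin m) :
    ContDiffOn ℝ ∞ (fun y => (metric X y)⁻¹ i j) U := by
  have hd : ∀ A : EuclideanSpace ℝ (Fin m) → Matrix (Fin m) (Fin m) ℝ,
      (∀ k l, ContDiffOn ℝ ∞ (fun y => A y k l) U) → ContDiffOn ℝ ∞ (fun y => (A y).det) U := by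
    intro A hA
    simp only [Matrix.det_apply']
    exact ContDiffOn.sum fun σ _ => contDiffOn_const.mul (contDiffOn_prod fun k _ => hA _ _)
  -- Cramer's rule: entries of the inverse are quotients of determinants, hence smooth where the
  -- determinant does not vanish.
  have : ∀ y, (metric X y)⁻¹ i j
      = ((metric X y).det)⁻¹ * ((metric X y).updateRow j (Pi.single i 1)).det := by
    intro y
    rw [Matrix.inv_def, Matrix.smul_apply, Matrix.adjugate_apply, Ring.inverse_eq_inv', smul_eq_mul]
  simp only [this]
  refine ContDiffOn.mul ((hd _ h.contDiffOn_metric).inv fun y hy => (h.isUnit_det_metric hy).ne_zero)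
    (hd _ fun k l => ?_)
  by_cases hk : k = j
  · subst hk
    simpa using contDiffOn_const
  · simpa [Matrix.updateRow_ne hk] using h.contDiffOn_metric k l

theorem sum_metric_inv_mul_metric (h : IsLocalImmersion X U) (hx : x ∈ U) (i j : Fin m) :
    ∑ k, (metric X x)⁻¹ i k * metric X x k j = if i = j then 1 else 0 := by
  rw [← Matrix.mul_apply, Matrix.nonsing_inv_mul _ (h.isUnit_det_metric hx), Matrix.one_apply]

theorem inner_pd_self (h : IsLocalImmersion X U) (hx : x ∈ U) (i : Fin m) :
    inner ℝ (pd i X x) (X x) = (0 : ℝ) := by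
  have hd := h.differentiableAt h.contDiffOn hx
  have h1 := pd_inner i hd hd
  rw [pd_congr i h.isOpen hx h.inner_self, pd_const, real_inner_comm] at h1
  linarith

/-- Differentiate `⟨∂_j X, X⟩ = 0`. This radial component is what later contributes the curvature of
the sphere to the Gauss equation. -/
theorem inner_pd_pd_self (h : IsLocalImmersion X U) (hx : x ∈ U) (i j : Fin m) :
    inner ℝ (pd i (pd j X) x) (X x) = - metric X x i j := by
  have h1 := pd_inner i (h.differentiableAt (h.contDiffOn_pd j) hx) (h.differentiableAt h.contDiffOn hx)
  rw [pd_congr i h.isOpen hx (fun y hy => h.inner_pd_self hy j), pd_const] at h1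
  have : metric X x i j = inner ℝ (pd j X x) (pd i X x) := metric_comm X x i j
  linarith

theorem pd_pd_comm (h : IsLocalImmersion X U) (hx : x ∈ U) (i j : Fin m) :
    pd i (pd j X) x = pd j (pd i X) x :=
  pd_comm i j h.isOpen hx h.contDiffOn

theorem pd_metric (h : IsLocalImmersion X U) (hx : x ∈ U) (i j k : Fin m) :
    pd i (fun y => metric X y j k) x
      = inner ℝ (pd j X x) (pd i (pd k X) x) + inner ℝ (pd i (pd j X) x) (pd k X x) :=
  pd_inner i (h.differentiableAt (h.contDiffOn_pd j) hx) (h.differentiableAt (h.contDiffOn_pd k) hx)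

/-- By symmetry of second derivatives, all but one pair of terms in the Koszul-type expression
cancel. -/
theorem christoffel_eq (h : IsLocalImmersion X U) (hx : x ∈ U) (i j k : Fin m) :
    christoffel X i j k x = ∑ l, (metric X x)⁻¹ k l * inner ℝ (pd i (pd j X) x) (pd l X x) := by
  rw [christoffel, Finset.mul_sum]
  refine Finset.sum_congr rfl fun l _ => ?_
  rw [h.pd_metric hx, h.pd_metric hx, h.pd_metric hx, h.pd_pd_comm hx j i, h.pd_pd_comm hx l i,
    h.pd_pd_comm hx l j, real_inner_comm (pd j X x)]
  ring

theorem christoffel_comm (h : IsLocalImmersion X U) (hx : x ∈ U) (i j k : Fin m) :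
    christoffel X i j k x = christoffel X j i k x := by
  simp only [h.christoffel_eq hx, h.pd_pd_comm hx i j]

theorem contDiffOn_christoffel (h : IsLocalImmersion X U) (i j k : Fin m) :
    ContDiffOn ℝ ∞ (christoffel X i j k) U := by
  have : ContDiffOn ℝ ∞ (fun y => ∑ l, (metric X y)⁻¹ k l *
      inner ℝ (pd i (pd j X) y) (pd l X y)) U :=
    ContDiffOn.sum fun l _ =>
      (h.contDiffOn_metric_inv k l).mul ((h.contDiffOn_pd_pd i j).inner ℝ (h.contDiffOn_pd l))
  exact this.congr fun y hy => h.christoffel_eq hy i j k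

theorem sum_christoffel_mul_metric (h : IsLocalImmersion X U) (hx : x ∈ U) (i j l : Fin m) :
    ∑ k, christoffel X i j k x * metric X x k l = inner ℝ (pd i (pd j X) x) (pd l X x) := by
  simp only [h.christoffel_eq hx, Finset.sum_mul]
  rw [Finset.sum_comm]
  have : ∀ s, ∑ k, (metric X x)⁻¹ k s * inner ℝ (pd i (pd j X) x) (pd s X x) * metric X x k l
      = inner ℝ (pd i (pd j X) x) (pd s X x) * if s = l then 1 else 0 := by
    intro s
    rw [← h.sum_metric_inv_mul_metric hx, Finset.mul_sum]
    refine Finset.sum_congr rfl fun k _ => ?_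
    rw [metric_inv_comm X x k s]; ring
  simp [this]

theorem secondForm_eq (h : IsLocalImmersion X U) (hx : x ∈ U) (i j : Fin m) :
    secondForm X i j x = pd i (pd j X) x + metric X x i j • X x
      - ∑ k, christoffel X i j k x • pd k X x := by
  rw [secondForm, covDeriv, sphereProj, h.inner_pd_pd_self hx]
  simp

theorem secondForm_comm (h : IsLocalImmersion X U) (hx : x ∈ U) (i j : Fin m) :
    secondForm X i j x = secondForm X j i x := by
  simp only [h.secondForm_eq hx, h.pd_pd_comm hx i j, metric_comm X x i j, h.christoffel_comm hx i j]

theorem contDiffOn_secondForm (h : IsLocalImmersion X U) (i j : Fin m) :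
    ContDiffOn ℝ ∞ (secondForm X i j) U := by
  have : ContDiffOn ℝ ∞ (fun y => pd i (pd j X) y + metric X y i j • X y
      - ∑ k, christoffel X i j k y • pd k X y) U :=
    ((h.contDiffOn_pd_pd i j).add ((h.contDiffOn_metric i j).smul h.contDiffOn)).sub
      (ContDiffOn.sum fun k _ => (h.contDiffOn_christoffel i j k).smul (h.contDiffOn_pd k))
  exact this.congr fun y hy => h.secondForm_eq hy i j

theorem inner_secondForm_self (h : IsLocalImmersion X U) (hx : x ∈ U) (i j : Fin m) :
    inner ℝ (secondForm X i j x) (X x) = (0 : ℝ) := by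
  rw [secondForm, inner_sub_left, covDeriv, inner_sphereProj_self (h.inner_self x hx), sum_inner]
  simp [real_inner_smul_left, h.inner_pd_self hx]

theorem inner_secondForm_pd (h : IsLocalImmersion X U) (hx : x ∈ U) (i j l : Fin m) :
    inner ℝ (secondForm X i j x) (pd l X x) = (0 : ℝ) := by
  rw [secondForm, inner_sub_left, covDeriv,
    inner_sphereProj_of_orthogonal ((real_inner_comm _ _).trans (h.inner_pd_self hx l)), sum_inner,
    ← h.sum_christoffel_mul_metric hx]
  simp [real_inner_smul_left, metric]

/-- Normal vectors pair with the second derivatives of `X` as with the second fundamental form. -/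
theorem inner_pd_pd_eq_inner_secondForm (h : IsLocalImmersion X U) (hx : x ∈ U) (i j : Fin m)
    {ν : EuclideanSpace ℝ (Fin (n + 1))} (hν : inner ℝ (X x) ν = (0 : ℝ))
    (hν' : ∀ k, inner ℝ (pd k X x) ν = (0 : ℝ)) :
    inner ℝ (pd i (pd j X) x) ν = (inner ℝ (secondForm X i j x) ν : ℝ) := by
  rw [h.secondForm_eq hx, inner_sub_left, inner_add_left, sum_inner]
  simp [real_inner_smul_left, hν, hν']

end IsLocalImmersion

/-! ### The unit sphere has constant curvature one. -/

section Sphere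

variable {n : ℕ}

theorem fderiv_sphereProj_apply (w z v : EuclideanSpace ℝ (Fin (n + 1))) :
    fderiv ℝ (fun z => sphereProj z w) z v
      = -((inner ℝ w z : ℝ) • v + (inner ℝ w v : ℝ) • z) := by
  have h1 : DifferentiableAt ℝ (fun z : EuclideanSpace ℝ (Fin (n + 1)) => (inner ℝ w z : ℝ)) z :=
    (differentiableAt_const w).inner ℝ differentiableAt_fun_id
  simp only [sphereProj]
  rw [fderiv_const_sub, fderiv_fun_smul h1 differentiableAt_fun_id]
  simp [fderiv_inner_apply ℝ (differentiableAt_const w) differentiableAt_fun_id]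

/-- Along the sphere the inner derivative is `-⟨w, z⟩ V(z)`. Since `⟨w, y⟩ = 0`, a further
derivative at `y` only sees the scalar factor. -/
theorem sphereConn_sphereProj (u v : EuclideanSpace ℝ (Fin (n + 1)))
    {y w : EuclideanSpace ℝ (Fin (n + 1))}
    (hy : inner ℝ y y = (1 : ℝ)) (hu : inner ℝ u y = (0 : ℝ)) (hv : inner ℝ v y = (0 : ℝ))
    (hw : inner ℝ w y = (0 : ℝ)) :
    sphereConn (fun z => sphereProj z u) (sphereConn (fun z => sphereProj z v)
      fun z => sphereProj z w) y = -(inner ℝ u w : ℝ) • v := by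
  have hconn : (sphereConn (fun z => sphereProj z v) fun z => sphereProj z w)
      = fun z => -((inner ℝ w z : ℝ) • sphereProj z v + (inner ℝ w (sphereProj z v) : ℝ) • z)
        - (inner ℝ (-((inner ℝ w z : ℝ) • sphereProj z v
          + (inner ℝ w (sphereProj z v) : ℝ) • z)) z : ℝ) • z := by
    funext z
    rw [sphereConn, fderiv_sphereProj_apply, sphereProj]
  obtain ⟨L, hP, hL⟩ : ∃ L : EuclideanSpace ℝ (Fin (n + 1)) →L[ℝ] EuclideanSpace ℝ (Fin (n + 1)),
      HasFDerivAt (fun z => sphereProj z v) L y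
      ∧ L u = -(inner ℝ v u : ℝ) • y := by
    refine ⟨_, DifferentiableAt.hasFDerivAt ?_, ?_⟩
    · exact (differentiableAt_const v).sub
        (((differentiableAt_const v).inner ℝ differentiableAt_fun_id).smul differentiableAt_fun_id)
    · rw [fderiv_sphereProj_apply, hv]
      module
  have hid := hasFDerivAt_id (𝕜 := ℝ) y
  have hwi := (hasFDerivAt_const w y).inner ℝ hid
  have hwP := (hasFDerivAt_const w y).inner ℝ hP
  have hF := ((hwi.smul hP).add (hwP.smul hid)).neg
  have hG := hF.sub ((hF.inner ℝ hid).smul hid)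
  have hyu : inner ℝ y u = (0 : ℝ) := (real_inner_comm _ _).trans hu
  have hPu : sphereProj y u = u := by simp [sphereProj, hu]
  have hn : ‖y‖ = 1 := by
    rw [real_inner_self_eq_norm_sq] at hy
    nlinarith [norm_nonneg y]
  have key := congrArg (fun L => L u) (hG.fderiv)
  rw [hconn, sphereConn, hPu]
  refine (congrArg (sphereProj y) key).trans ?_
  simp [hL, hn, sphereProj, hw, hv, hyu, hu, inner_add_left, real_inner_smul_left,
    inner_neg_left, real_inner_smul_right, real_inner_comm u w]

/-- The chosen extensions commute at `y`: the derivative of one along the other is `-⟨u, v⟩ y`,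
symmetric in `u` and `v`. So the bracket term drops out. -/
theorem sphereCurvature_eq {y u v w : EuclideanSpace ℝ (Fin (n + 1))}
    (hy : inner ℝ y y = (1 : ℝ)) (hu : inner ℝ u y = (0 : ℝ)) (hv : inner ℝ v y = (0 : ℝ))
    (hw : inner ℝ w y = (0 : ℝ)) :
    sphereCurvature y u v w = (inner ℝ v w : ℝ) • u - (inner ℝ u w : ℝ) • v := by
  have hb : VectorField.lieBracket ℝ (fun z => sphereProj z u) (fun z => sphereProj z v) y = 0 := by
    rw [VectorField.lieBracket, fderiv_sphereProj_apply, fderiv_sphereProj_apply]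
    simp [sphereProj, hu, hv, real_inner_comm]
  have hc : sphereConn (VectorField.lieBracket ℝ (fun z => sphereProj z u) fun z => sphereProj z v)
      (fun z => sphereProj z w) y = 0 := by
    rw [sphereConn, hb]
    simp [sphereProj]
  rw [sphereCurvature]
  simp only [hc, sphereConn_sphereProj u v hy hu hv hw, sphereConn_sphereProj v u hy hv hu hw]
  module

end Sphere

namespace IsLocalImmersion

variable {m n : ℕ} {X : EuclideanSpace ℝ (Fin m) → EuclideanSpace ℝ (Fin (n + 1))}
  {U : Set (EuclideanSpace ℝ (Fin m))} {x : EuclideanSpace ℝ (Fin m)}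

/-! ### The Gauss equation -/

theorem inner_pd_pd_pd_pd (h : IsLocalImmersion X U) (hx : x ∈ U) (i j k p : Fin m) :
    inner ℝ (pd j (pd k X) x) (pd i (pd p X) x)
      = inner ℝ (secondForm X j k x) (secondForm X i p x) + metric X x j k * metric X x i p
        + ∑ s, christoffel X j k s x * inner ℝ (pd s X x) (pd i (pd p X) x) := by
  have e1 : pd j (pd k X) x = secondForm X j k x - metric X x j k • X x
      + ∑ s, christoffel X j k s x • pd s X x := by
    rw [h.secondForm_eq hx]; abel
  have e2 : inner ℝ (secondForm X j k x) (pd i (pd p X) x)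
      = (inner ℝ (secondForm X j k x) (secondForm X i p x) : ℝ) := by
    rw [real_inner_comm, h.inner_pd_pd_eq_inner_secondForm hx, real_inner_comm]
    · rw [real_inner_comm, h.inner_secondForm_self hx]
    · intro l; rw [real_inner_comm, h.inner_secondForm_pd hx]
  have e3 : inner ℝ (X x) (pd i (pd p X) x) = - metric X x i p := by
    rw [real_inner_comm, h.inner_pd_pd_self hx]
  rw [e1, inner_add_left, inner_sub_left, real_inner_smul_left, e2, e3, sum_inner]
  simp only [real_inner_smul_left]
  ring

/-- Half of the Gauss equation: differentiate `Γ^l_jk g_lp = ⟨∂_j ∂_k X, ∂_p X⟩`. The terms `Γ^s_jk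
⟨∂_s X, ∂_i ∂_p X⟩` occur on both sides and cancel. -/
theorem sum_pd_christoffel_mul_metric (h : IsLocalImmersion X U) (hx : x ∈ U) (i j k p : Fin m) :
    ∑ l, (pd i (christoffel X j k l) x + ∑ s, christoffel X j k s x * christoffel X i s l x)
        * metric X x l p
      = inner ℝ (pd i (pd j (pd k X)) x) (pd p X x)
        + (inner ℝ (secondForm X j k x) (secondForm X i p x) + metric X x j k * metric X x i p) := by
  have h1 := pd_congr i h.isOpen hx fun y hy => h.sum_christoffel_mul_metric hy j k p
  have hd : ∀ l, DifferentiableAt ℝ (christoffel X j k l) x :=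
    fun l => h.differentiableAt (h.contDiffOn_christoffel j k l) hx
  have hg : ∀ l, DifferentiableAt ℝ (fun y => metric X y l p) x :=
    fun l => h.differentiableAt (h.contDiffOn_metric l p) hx
  rw [pd_sum (f := fun l y => christoffel X j k l y * metric X y l p) i _
      fun l _ => (hd l).mul (hg l),
    pd_inner i (h.differentiableAt (h.contDiffOn_pd_pd j k) hx)
      (h.differentiableAt (h.contDiffOn_pd p) hx), h.inner_pd_pd_pd_pd hx] at h1
  simp only [pd_mul i (hd _) (hg _), h.pd_metric hx, mul_add, Finset.sum_add_distrib] at h1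
  have h2 : ∑ l, (∑ s, christoffel X j k s x * christoffel X i s l x) * metric X x l p
      = ∑ s, christoffel X j k s x * inner ℝ (pd i (pd s X) x) (pd p X x) := by
    simp only [← h.sum_christoffel_mul_metric hx, Finset.sum_mul, Finset.mul_sum]
    rw [Finset.sum_comm]
    simp only [mul_assoc]
  simp only [add_mul, Finset.sum_add_distrib, h2]
  linarith

/-- The Gauss equation for a submanifold of the unit sphere. -/
theorem sum_riemann_mul_metric (h : IsLocalImmersion X U) (hx : x ∈ U) (i j k p : Fin m) :
    ∑ l, riemann X i j k l x * metric X x l p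
      = inner ℝ (secondForm X j k x) (secondForm X i p x) + metric X x j k * metric X x i p
        - (inner ℝ (secondForm X i k x) (secondForm X j p x) + metric X x i k * metric X x j p) := by
  have h1 := h.sum_pd_christoffel_mul_metric hx i j k p
  have h2 := h.sum_pd_christoffel_mul_metric hx j i k p
  -- The third derivatives of `X` now agree and disappear on antisymmetrizing in `i` and `j`.
  rw [pd_comm j i h.isOpen hx (h.contDiffOn_pd k)] at h2
  have h3 : ∀ l, riemann X i j k l x * metric X x l p
      = (pd i (christoffel X j k l) x + ∑ s, christoffel X j k s x * christoffel X i s l x)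
        * metric X x l p
      - (pd j (christoffel X i k l) x + ∑ s, christoffel X i k s x * christoffel X j s l x)
        * metric X x l p := by
    intro l
    rw [riemann, Finset.sum_sub_distrib]
    ring
  simp only [h3, Finset.sum_sub_distrib]
  linarith

/-! ### Parallel normal fields -/

section Parallel

variable {ξ : EuclideanSpace ℝ (Fin m) → EuclideanSpace ℝ (Fin (n + 1))}

/-- The Weingarten formula for parallel normal fields. -/
theorem covDeriv_of_parallel (h : IsLocalImmersion X U)
    (hξ : ContDiffOn ℝ ∞ ξ U) (hξ' : ∀ y ∈ U, ∀ k, inner ℝ (ξ y) (pd k X y) = (0 : ℝ))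
    (hpar : ∀ y ∈ U, ∀ i, normalDeriv X i ξ y = 0)
    (hξ'' : inner ℝ (ξ x) (X x) = (0 : ℝ)) (hx : x ∈ U) (i : Fin m) :
    covDeriv X i ξ x = - ∑ l, (∑ k, (metric X x)⁻¹ k l * inner ℝ (secondForm X i k x) (ξ x)) •
      pd l X x := by
  have hk : ∀ k, inner ℝ (covDeriv X i ξ x) (pd k X x)
      = -(inner ℝ (secondForm X i k x) (ξ x) : ℝ) := by
    -- Differentiate `⟨ξ, ∂_k X⟩ = 0`; parallelism then says that these tangential components
    -- determine `∇_i ξ`.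
    intro k
    rw [covDeriv, inner_sphereProj_of_orthogonal ((real_inner_comm _ _).trans (h.inner_pd_self hx k))]
    have h1 := pd_inner i (h.differentiableAt hξ hx) (h.differentiableAt (h.contDiffOn_pd k) hx)
    rw [pd_congr i h.isOpen hx fun y hy => hξ' y hy k, pd_const,
      real_inner_comm, h.inner_pd_pd_eq_inner_secondForm hx i k
        ((real_inner_comm _ _).trans hξ'') fun l => (real_inner_comm _ _).trans (hξ' x hx l)] at h1
    linarith
  have h2 := hpar x hx i
  rw [normalDeriv, normalPart, sub_eq_zero] at h2
  rw [h2]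
  simp only [hk, mul_neg, neg_smul, Finset.sum_neg_distrib, Finset.sum_smul]
  rw [Finset.sum_comm]

/-- Differentiate the Weingarten formula, valid on all of `U`. Against a normal `ν` only the terms
where the derivative falls on `∂_l X` survive, and they give `-B(∂_i, A_ξ ∂_j)`. -/
theorem inner_covDeriv_covDeriv_of_parallel (h : IsLocalImmersion X U)
    (hξ : ContDiffOn ℝ ∞ ξ U) (hξ' : ∀ y ∈ U, ∀ k, inner ℝ (ξ y) (pd k X y) = (0 : ℝ))
    (hpar : ∀ y ∈ U, ∀ i, normalDeriv X i ξ y = 0)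
    (hξ'' : ∀ y ∈ U, inner ℝ (ξ y) (X y) = (0 : ℝ))
    (hx : x ∈ U) (i j : Fin m)
    {ν : EuclideanSpace ℝ (Fin (n + 1))} (hν : inner ℝ (X x) ν = (0 : ℝ))
    (hν' : ∀ k, inner ℝ (pd k X x) ν = (0 : ℝ)) :
    inner ℝ (covDeriv X i (covDeriv X j ξ) x) ν
      = -∑ l, (∑ k, (metric X x)⁻¹ k l * inner ℝ (secondForm X j k x) (ξ x))
          * inner ℝ (secondForm X i l x) ν := by
  have hs : ∀ l, ContDiffOn ℝ ∞
      (fun y => ∑ k, (metric X y)⁻¹ k l * inner ℝ (secondForm X j k y) (ξ y)) U := fun l =>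
    ContDiffOn.sum fun k _ => (h.contDiffOn_metric_inv k l).mul
      ((h.contDiffOn_secondForm j k).inner ℝ hξ)
  have hd := fun l => h.differentiableAt (hs l) hx
  have hX := fun l => h.differentiableAt (h.contDiffOn_pd l) hx
  rw [covDeriv, inner_sphereProj_of_orthogonal hν,
    pd_congr (g := fun y => (-1 : ℝ) • ∑ l, (∑ k, (metric X y)⁻¹ k l *
      inner ℝ (secondForm X j k y) (ξ y)) • pd l X y) i h.isOpen hx fun y hy => by
      rw [h.covDeriv_of_parallel hξ hξ' hpar (hξ'' y hy) hy, neg_one_smul],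
    pd_const_smul, pd_sum (f := fun l y => (∑ k, (metric X y)⁻¹ k l *
      inner ℝ (secondForm X j k y) (ξ y)) • pd l X y) i _ fun l _ => (hd l).smul (hX l),
    real_inner_smul_left, sum_inner]
  simp only [pd_smul i (hd _) (hX _), inner_add_left, real_inner_smul_left, hν', mul_zero, add_zero,
    h.inner_pd_pd_eq_inner_secondForm hx _ _ hν hν', neg_mul, one_mul]

/-- The Christoffel correction is tangential, so only the trace `⟨trace B(A_ξ ·, ·), ν⟩` remains. -/
theorem inner_roughLaplacian_of_parallel (h : IsLocalImmersion X U)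
    (hξ : ContDiffOn ℝ ∞ ξ U) (hξ' : ∀ y ∈ U, ∀ k, inner ℝ (ξ y) (pd k X y) = (0 : ℝ))
    (hpar : ∀ y ∈ U, ∀ i, normalDeriv X i ξ y = 0)
    (hξ'' : ∀ y ∈ U, inner ℝ (ξ y) (X y) = (0 : ℝ))
    (hx : x ∈ U)
    {ν : EuclideanSpace ℝ (Fin (n + 1))} (hν : inner ℝ (X x) ν = (0 : ℝ))
    (hν' : ∀ k, inner ℝ (pd k X x) ν = (0 : ℝ)) :
    inner ℝ (roughLaplacian X ξ x) ν
      = ∑ i, ∑ j, (metric X x)⁻¹ i j *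
          ∑ l, (∑ k, (metric X x)⁻¹ k l * inner ℝ (secondForm X j k x) (ξ x))
            * inner ℝ (secondForm X i l x) ν := by
  have hk : ∀ k, inner ℝ (covDeriv X k ξ x) ν = (0 : ℝ) := by
    intro k
    rw [h.covDeriv_of_parallel hξ hξ' hpar (hξ'' x hx) hx, inner_neg_left, sum_inner]
    simp [real_inner_smul_left, hν']
  simp only [roughLaplacian, inner_neg_left, sum_inner, inner_sub_left, real_inner_smul_left, hk,
    h.inner_covDeriv_covDeriv_of_parallel hξ hξ' hpar hξ'' hx _ _ hν hν', mul_zero,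
    Finset.sum_const_zero, sub_zero, mul_neg, Finset.sum_neg_distrib, neg_neg]

end Parallel

/-! ### The tension field -/

theorem contDiffOn_tension (h : IsLocalImmersion X U) : ContDiffOn ℝ ∞ (tension X) U :=
  ContDiffOn.sum fun i _ => ContDiffOn.sum fun j _ =>
    (h.contDiffOn_metric_inv i j).smul (h.contDiffOn_secondForm i j)

theorem inner_tension_self (h : IsLocalImmersion X U) (hx : x ∈ U) :
    inner ℝ (tension X x) (X x) = (0 : ℝ) := by
  simp [tension, sum_inner, real_inner_smul_left, h.inner_secondForm_self hx]

theorem inner_tension_pd (h : IsLocalImmersion X U) (hx : x ∈ U) (k : Fin m) :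
    inner ℝ (tension X x) (pd k X x) = (0 : ℝ) := by
  simp [tension, sum_inner, real_inner_smul_left, h.inner_secondForm_pd hx]

theorem tension_eq_smul_meanCurvature (x : EuclideanSpace ℝ (Fin m)) :
    tension X x = (m : ℝ) • meanCurvature X x := by
  rcases Nat.eq_zero_or_pos m with rfl | hm
  -- For `m = 0` the factor `1 / m` is zero, but both sides are empty sums.
  · simp [tension]
  · have : (m : ℝ) ≠ 0 := by positivity
    rw [meanCurvature, smul_smul, mul_one_div_cancel this, one_smul, tension]

theorem normalDeriv_const_smul (c : ℝ)
    (ξ : EuclideanSpace ℝ (Fin m) → EuclideanSpace ℝ (Fin (n + 1)))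
    (i : Fin m) : normalDeriv X i (fun y => c • ξ y) x = c • normalDeriv X i ξ x := by
  have h1 : covDeriv X i (fun y => c • ξ y) x = c • covDeriv X i ξ x := by
    simp only [covDeriv, sphereProj, pd_const_smul, smul_sub, real_inner_smul_left, smul_smul]
  simp only [normalDeriv, normalPart, h1, smul_sub, Finset.smul_sum, smul_smul,
    real_inner_smul_left, mul_left_comm]

/-- As `τ` is normal, `R(∂_i, τ) ∂_j = -g_ij τ`, and the trace of `g` is `m`. -/
theorem sum_smul_sphereCurvature_tension (h : IsLocalImmersion X U) (hx : x ∈ U) :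
    ∑ i, ∑ j, (metric X x)⁻¹ i j •
        sphereCurvature (X x) (pd i X x) (tension X x) (pd j X x) = -(m : ℝ) • tension X x := by
  have h1 : ∀ i j, (metric X x)⁻¹ i j •
        sphereCurvature (X x) (pd i X x) (tension X x) (pd j X x)
      = -((metric X x)⁻¹ i j * metric X x j i) • tension X x := by
    intro i j
    rw [sphereCurvature_eq (h.inner_self x hx) (h.inner_pd_self hx i) (h.inner_tension_self hx)
      (h.inner_pd_self hx j), h.inner_tension_pd hx, metric_comm X x j i, metric, Matrix.of_apply]
    module
  simp only [h1, ← Finset.sum_smul, Finset.sum_neg_distrib, h.sum_metric_inv_mul_metric hx]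
  simp

/-- The normal part of the biharmonic equation for parallel mean curvature. -/
theorem sum_smul_secondForm_eq_tension (h : IsLocalImmersion X U) (hx : x ∈ U)
    (hbi : bitension X x = 0)
    (hpar : ∀ y ∈ U, ∀ i, normalDeriv X i (meanCurvature X) y = 0) :
    ∑ i, ∑ j, ∑ l, ∑ k, ((metric X x)⁻¹ i j * ((metric X x)⁻¹ k l *
        inner ℝ (secondForm X j k x) (tension X x))) • secondForm X i l x
      = (m : ℝ) • tension X x := by
  have hparT : ∀ y ∈ U, ∀ i, normalDeriv X i (tension X) y = 0 := by
    intro y hy i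
    rw [show tension X = fun y => (m : ℝ) • meanCurvature X y from
      funext tension_eq_smul_meanCurvature, normalDeriv_const_smul, hpar y hy i, smul_zero]
  rw [bitension, h.sum_smul_sphereCurvature_tension hx] at hbi
  set V := ∑ i, ∑ j, ∑ l, ∑ k, ((metric X x)⁻¹ i j * ((metric X x)⁻¹ k l *
        inner ℝ (secondForm X j k x) (tension X x))) • secondForm X i l x with hV
  -- The difference of the two sides is itself normal, so it can serve as the test vector: the
  -- equation forces `⟨ν, ν⟩ = 0`, and the tangential part of `Δτ` is never needed.
  set ν := V - (m : ℝ) • tension X x with hνdef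
  have hν : inner ℝ (X x) ν = (0 : ℝ) := by
    rw [real_inner_comm]
    simp [hνdef, hV, inner_sub_left, sum_inner, real_inner_smul_left, h.inner_secondForm_self hx,
      h.inner_tension_self hx]
  have hν' : ∀ k, inner ℝ (pd k X x) ν = (0 : ℝ) := by
    intro k
    rw [real_inner_comm]
    simp [hνdef, hV, inner_sub_left, sum_inner, real_inner_smul_left, h.inner_secondForm_pd hx,
      h.inner_tension_pd hx]
  have h1 := h.inner_roughLaplacian_of_parallel h.contDiffOn_tension
    (fun y hy k => h.inner_tension_pd hy k) hparT (fun y hy => h.inner_tension_self hy) hx hν hν'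
  have h2 : inner ℝ V ν = (inner ℝ (roughLaplacian X (tension X) x) ν : ℝ) := by
    rw [h1, hV]
    simp only [sum_inner, real_inner_smul_left, Finset.mul_sum, Finset.sum_mul, mul_assoc]
  have h3 : roughLaplacian X (tension X) x = (m : ℝ) • tension X x := by
    have := sub_eq_zero.1 hbi
    rw [neg_smul] at this
    exact neg_injective this
  have h4 : inner ℝ ν ν = (0 : ℝ) := by
    conv_lhs => rw [hνdef]
    rw [inner_sub_left, h2, h3, sub_self]
  exact sub_eq_zero.1 (inner_self_eq_zero.1 h4)

end IsLocalImmersion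

/-! ### Orthonormal frames -/

section Frame

variable {m n : ℕ} {X : EuclideanSpace ℝ (Fin m) → EuclideanSpace ℝ (Fin (n + 1))}
  {x : EuclideanSpace ℝ (Fin m)} {e : Fin m → EuclideanSpace ℝ (Fin m)}

theorem sum_rotate {ι κ σ G : Type*} [Fintype ι] [Fintype κ] [Fintype σ] [AddCommMonoid G]
    (f : ι → κ → σ → G) : ∑ i, ∑ j, ∑ k, f i j k = ∑ j, ∑ k, ∑ i, f i j k := by
  rw [Finset.sum_comm]
  exact Finset.sum_congr rfl fun _ _ => Finset.sum_comm

section Quadratic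

variable {G : Type*} [NormedAddCommGroup G] [InnerProductSpace ℝ G] (b : Fin m → Fin m → G)
  (u v : Fin m → ℝ)

/-- This and the next lemma contract the two kinds of product in the Gauss equation. Taking values
in `G` lets them serve both for `B` and for the metric (`G = ℝ`). -/
theorem inner_sum_sum_smul_sum_sum_smul :
    inner ℝ (∑ i, ∑ j, (v i * v j) • b i j) (∑ i, ∑ j, (u i * u j) • b i j)
      = ∑ i, ∑ j, ∑ k, ∑ p, u i * v j * v k * u p * (inner ℝ (b j k) (b i p) : ℝ) := by
  rw [sum_rotate]
  simp only [sum_inner, real_inner_smul_left]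
  simp only [inner_sum, real_inner_smul_right, Finset.mul_sum]
  refine Finset.sum_congr rfl fun _ _ => Finset.sum_congr rfl fun _ _ =>
    Finset.sum_congr rfl fun _ _ => Finset.sum_congr rfl fun _ _ => ?_
  ring

theorem norm_sum_sum_smul_sq (hb : ∀ i j, b i j = b j i) :
    ‖∑ i, ∑ j, (u i * v j) • b i j‖ ^ 2
      = ∑ i, ∑ j, ∑ k, ∑ p, u i * v j * v k * u p * (inner ℝ (b i k) (b j p) : ℝ) := by
  rw [← real_inner_self_eq_norm_sq]
  simp only [sum_inner, real_inner_smul_left]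
  simp only [inner_sum, real_inner_smul_right, Finset.mul_sum]
  refine Finset.sum_congr rfl fun i _ => ?_
  rw [sum_rotate, sum_rotate]
  refine Finset.sum_congr rfl fun j _ => Finset.sum_congr rfl fun k _ =>
    Finset.sum_congr rfl fun p _ => ?_
  rw [hb p j]
  ring

end Quadratic

/-- Orthonormality is `Eᵀ g E = 1`. For square matrices this can be rotated to `E Eᵀ g = 1`, so `E
Eᵀ = g⁻¹` and traces become frame sums. -/
theorem sum_frame_mul_frame (he : ∀ i j, metricForm X x (e i) (e j) = if i = j then 1 else 0)
    (k l : Fin m) : ∑ p, e p k * e p l = (metric X x)⁻¹ k l := by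
  set E : Matrix (Fin m) (Fin m) ℝ := Matrix.of fun k p => e p k with hE
  have h1 : E.transpose * metric X x * E = 1 := by
    ext i j
    rw [Matrix.one_apply, ← he i j, metricForm, Matrix.mul_apply]
    simp only [Matrix.mul_apply, Matrix.transpose_apply, hE, Matrix.of_apply, Finset.sum_mul]
    rw [Finset.sum_comm]
    exact Finset.sum_congr rfl fun _ _ => Finset.sum_congr rfl fun _ _ => by ring
  have h2 : E * E.transpose * metric X x = 1 := by
    rw [Matrix.mul_assoc]
    exact mul_eq_one_comm.1 h1
  rw [Matrix.inv_eq_left_inv h2, Matrix.mul_apply]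
  rfl

theorem sum_metric_inv_smul {G : Type*} [AddCommGroup G] [Module ℝ G]
    (he : ∀ i j, metricForm X x (e i) (e j) = if i = j then 1 else 0) (c : Fin m → Fin m → G) :
    ∑ i, ∑ j, (metric X x)⁻¹ i j • c i j = ∑ p, ∑ i, ∑ j, (e p i * e p j) • c i j := by
  simp only [← sum_frame_mul_frame he, Finset.sum_smul]
  rw [sum_rotate]
  rw [sum_rotate]

theorem tension_eq_sum_frame (he : ∀ i j, metricForm X x (e i) (e j) = if i = j then 1 else 0) :
    tension X x = ∑ p, secondFormVec X x (e p) (e p) :=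
  sum_metric_inv_smul he _

theorem sum_metric_inv_smul_sum_metric_inv_smul {G : Type*} [AddCommGroup G] [Module ℝ G]
    (he : ∀ i j, metricForm X x (e i) (e j) = if i = j then 1 else 0)
    (β : Fin m → Fin m → ℝ) (b : Fin m → Fin m → G) :
    ∑ i, ∑ j, ∑ l, ∑ k, ((metric X x)⁻¹ i j * ((metric X x)⁻¹ k l * β j k)) • b i l
      = ∑ p, ∑ q, (∑ j, ∑ k, e p j * e q k * β j k) • ∑ i, ∑ l, (e p i * e q l) • b i l := by
  have h1 : ∀ i j, ∑ l, ∑ k, ((metric X x)⁻¹ i j * ((metric X x)⁻¹ k l * β j k)) • b i l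
      = (metric X x)⁻¹ i j • ∑ q, ∑ k, ∑ l, (e q k * e q l) • β j k • b i l := by
    intro i j
    rw [← sum_metric_inv_smul he, Finset.sum_comm]
    simp only [Finset.smul_sum, smul_smul]
  simp only [h1]
  rw [sum_metric_inv_smul he]
  refine Finset.sum_congr rfl fun p _ => ?_
  simp only [Finset.smul_sum, Finset.sum_smul]
  rw [sum_rotate, sum_rotate]
  refine Finset.sum_congr rfl fun q _ => Finset.sum_congr rfl fun i _ => ?_
  rw [sum_rotate, sum_rotate]
  refine Finset.sum_congr rfl fun l _ => Finset.sum_congr rfl fun j _ =>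
    Finset.sum_congr rfl fun k _ => ?_
  simp only [smul_smul]
  congr 1
  ring

theorem inner_secondFormVec (u v : EuclideanSpace ℝ (Fin m)) (ξ : EuclideanSpace ℝ (Fin (n + 1))) :
    inner ℝ (secondFormVec X x u v) ξ
      = ∑ i, ∑ j, u i * v j * inner ℝ (secondForm X i j x) ξ := by
  simp only [secondFormVec, sum_inner, real_inner_smul_left]

end Frame

/-! ### Weingarten operator and Gauss equation on tangent vectors. -/

namespace IsLocalImmersion

variable {m n : ℕ} {X : EuclideanSpace ℝ (Fin m) → EuclideanSpace ℝ (Fin (n + 1))}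
  {U : Set (EuclideanSpace ℝ (Fin m))} {x : EuclideanSpace ℝ (Fin m)}

theorem metricForm_weingarten (h : IsLocalImmersion X U) (hx : x ∈ U)
    (ξ : EuclideanSpace ℝ (Fin (n + 1)))
    (u v : EuclideanSpace ℝ (Fin m)) :
    metricForm X x v (weingarten X x ξ u) = inner ℝ (secondFormVec X x v u) ξ := by
  set b : Matrix (Fin m) (Fin m) ℝ := Matrix.of fun i j => inner ℝ (secondForm X i j x) ξ with hb
  have h1 : ∀ i, ∑ j, metric X x i j * weingarten X x ξ u j = ∑ j, b i j * u j := by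
    intro i
    have : Matrix.mulVec (metric X x) (Matrix.mulVec ((metric X x)⁻¹ * b) u.ofLp)
        = Matrix.mulVec b u.ofLp := by
      rw [Matrix.mulVec_mulVec, ← Matrix.mul_assoc,
        Matrix.mul_nonsing_inv _ (h.isUnit_det_metric hx), Matrix.one_mul]
    exact congrFun this i
  have h2 : ∀ i, ∑ j, metric X x i j * v i * weingarten X x ξ u j = v i * ∑ j, b i j * u j := by
    intro i
    rw [← h1, Finset.mul_sum]
    exact Finset.sum_congr rfl fun _ _ => by ring
  rw [metricForm, inner_secondFormVec]
  simp only [h2, Finset.mul_sum, hb, Matrix.of_apply]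
  exact Finset.sum_congr rfl fun _ _ => Finset.sum_congr rfl fun _ _ => by ring

/-- The Gauss equation for tangent vectors. -/
theorem metricForm_curvatureVec (h : IsLocalImmersion X U) (hx : x ∈ U)
    (u v : EuclideanSpace ℝ (Fin m)) :
    metricForm X x (curvatureVec X x u v v) u
      = inner ℝ (secondFormVec X x v v) (secondFormVec X x u u)
        - ‖secondFormVec X x u v‖ ^ 2
        + (metricForm X x u u * metricForm X x v v - metricForm X x u v ^ 2) := by
  have h1 : metricForm X x (curvatureVec X x u v v) u
      = ∑ i, ∑ j, ∑ k, ∑ p, u i * v j * v k * u p *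
          ∑ l, riemann X i j k l x * metric X x l p := by
    simp only [metricForm, curvatureVec, Finset.mul_sum, Finset.sum_mul]
    rw [sum_rotate, sum_rotate]
    refine Finset.sum_congr rfl fun i _ => ?_
    rw [Finset.sum_congr rfl fun l _ => sum_rotate _, sum_rotate]
    refine Finset.sum_congr rfl fun j _ => Finset.sum_congr rfl fun k _ => ?_
    rw [Finset.sum_comm]
    refine Finset.sum_congr rfl fun p _ => Finset.sum_congr rfl fun l _ => ?_
    ring
  have hm : ∀ w z : EuclideanSpace ℝ (Fin m),
      metricForm X x w z = ∑ i, ∑ j, (w i * z j) • metric X x i j := fun w z =>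
    Finset.sum_congr rfl fun _ _ => Finset.sum_congr rfl fun _ _ => by
      rw [smul_eq_mul]; ring
  have h2 := inner_sum_sum_smul_sum_sum_smul (metric X x) u v
  have h3 := norm_sum_sum_smul_sq (metric X x) u v (metric_comm X x)
  have h4 := inner_sum_sum_smul_sum_sum_smul (fun i j => secondForm X i j x) u v
  have h5 := norm_sum_sum_smul_sq (fun i j => secondForm X i j x) u v (h.secondForm_comm hx)
  have hR : ∀ a b : ℝ, inner ℝ a b = a * b := fun a b => by simp [mul_comm]
  simp only [← hm, hR] at h2 h3
  rw [Real.norm_eq_abs, sq_abs] at h3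
  rw [h1, secondFormVec, secondFormVec, secondFormVec, h4, h5, h3,
    mul_comm (metricForm X x u u), h2]
  simp only [h.sum_riemann_mul_metric hx, mul_add, mul_sub, Finset.sum_add_distrib,
    Finset.sum_sub_distrib]
  ring

end IsLocalImmersion

/-! ### The identities in an eigenframe. -/

namespace IsLocalImmersion

section Identities

variable {m n : ℕ} {X : EuclideanSpace ℝ (Fin m) → EuclideanSpace ℝ (Fin (n + 1))}
  {U : Set (EuclideanSpace ℝ (Fin m))} {x : EuclideanSpace ℝ (Fin m)}
  {e : Fin m → EuclideanSpace ℝ (Fin m)} {a : Fin m → ℝ}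

theorem inner_secondFormVec_eigenframe (h : IsLocalImmersion X U) (hx : x ∈ U)
    {ξ : EuclideanSpace ℝ (Fin (n + 1))}
    (he : ∀ i j, metricForm X x (e i) (e j) = if i = j then 1 else 0)
    (heig : ∀ i, weingarten X x ξ (e i) = a i • e i) (i j : Fin m) :
    inner ℝ (secondFormVec X x (e i) (e j)) ξ = if i = j then a i else 0 := by
  rw [← h.metricForm_weingarten hx, heig]
  have : metricForm X x (e i) (a j • e j) = a j * metricForm X x (e i) (e j) := by
    simp only [metricForm, Finset.mul_sum, PiLp.smul_apply, smul_eq_mul]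
    exact Finset.sum_congr rfl fun _ _ => Finset.sum_congr rfl fun _ _ => by ring
  rw [this, he]
  split_ifs with hij
  · rw [hij, mul_one]
  · rw [mul_zero]

/-- For biharmonic submanifolds with parallel mean curvature, `trace B(A_H ·, ·) = trace B`. -/
theorem sum_smul_secondFormVec_eigenframe (h : IsLocalImmersion X U) (hx : x ∈ U)
    (hbi : bitension X x = 0)
    (hpar : ∀ y ∈ U, ∀ i, normalDeriv X i (meanCurvature X) y = 0)
    (he : ∀ i j, metricForm X x (e i) (e j) = if i = j then 1 else 0)
    (heig : ∀ i, weingarten X x (meanCurvature X x) (e i) = a i • e i) :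
    ∑ p, a p • secondFormVec X x (e p) (e p) = (m : ℝ) • meanCurvature X x := by
  rcases Nat.eq_zero_or_pos m with rfl | hm
  · simp
  have hm' : (m : ℝ) ≠ 0 := by positivity
  have h1 := h.sum_smul_secondForm_eq_tension hx hbi hpar
  rw [sum_metric_inv_smul_sum_metric_inv_smul he
    fun j k => inner ℝ (secondForm X j k x) (tension X x)] at h1
  simp only [← inner_secondFormVec] at h1
  simp only [tension_eq_smul_meanCurvature, real_inner_smul_right,
    h.inner_secondFormVec_eigenframe hx he heig] at h1
  -- The equation for `τ = mH` carries an extra factor `m` on both sides, which is cancelled here.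
  rw [← smul_right_injective _ hm' |>.eq_iff, ← h1, Finset.smul_sum]
  refine Finset.sum_congr rfl fun p _ => ?_
  rw [Finset.sum_eq_single p (fun q _ hq => by simp [hq.symm]) (by simp), if_pos rfl, mul_smul]
  rfl

theorem sectional_add_norm_sq (h : IsLocalImmersion X U) (hx : x ∈ U)
    (he : ∀ i j, metricForm X x (e i) (e j) = if i = j then 1 else 0) {i j : Fin m} (hij : i ≠ j) :
    sectional X x (e i) (e j) + ‖secondFormVec X x (e i) (e j)‖ ^ 2
      = inner ℝ (secondFormVec X x (e j) (e j)) (secondFormVec X x (e i) (e i)) + 1 := by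
  rw [sectional, h.metricForm_curvatureVec hx]
  simp only [he, hij, if_true, if_false]
  ring

theorem curvature_identities (h : IsLocalImmersion X U) (hx : x ∈ U) (hbi : bitension X x = 0)
    (hpar : ∀ y ∈ U, ∀ i, normalDeriv X i (meanCurvature X) y = 0)
    (he : ∀ i j, metricForm X x (e i) (e j) = if i = j then 1 else 0)
    (heig : ∀ i, weingarten X x (meanCurvature X x) (e i) = a i • e i) (K : Fin m → Fin m → ℝ)
    (hK : ∀ i j, K i j = if i = j then 0 else sectional X x (e i) (e j)) :
    ((m : ℝ) * ‖meanCurvature X x‖ ^ 2 = ∑ i, a i ∧ ∑ i, a i = ∑ i, a i ^ 2) ∧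
    (2 * (m : ℝ) - 1) * (m * ‖meanCurvature X x‖ ^ 2)
      = (1 / 2) * ∑ i, ∑ j, (a i + a j) * (K i j + ‖secondFormVec X x (e i) (e j)‖ ^ 2) ∧
    ((m : ℝ) - 1 + m * ‖meanCurvature X x‖ ^ 2) * (m * ‖meanCurvature X x‖ ^ 2)
      = ∑ i, ∑ j, a i * a j * (K i j + ‖secondFormVec X x (e i) (e j)‖ ^ 2) := by
  set H := meanCurvature X x with hH
  have hB := h.inner_secondFormVec_eigenframe hx he heig
  have hT : ∑ p, secondFormVec X x (e p) (e p) = (m : ℝ) • H := by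
    rw [← tension_eq_sum_frame he, tension_eq_smul_meanCurvature]
  have hA := h.sum_smul_secondFormVec_eigenframe hx hbi hpar he heig
  rw [← hH] at hA
  have s1 : (m : ℝ) * ‖H‖ ^ 2 = ∑ i, a i := by
    rw [← real_inner_self_eq_norm_sq, ← real_inner_smul_left, ← hT, sum_inner]
    simp [hB]
  have s2 : (m : ℝ) * ‖H‖ ^ 2 = ∑ i, a i ^ 2 := by
    rw [← real_inner_self_eq_norm_sq, ← real_inner_smul_left, ← hA, sum_inner]
    simp [hB, real_inner_smul_left, sq]
  -- The convention `K_ii = 0` fits the Gauss equation with the correction `-δ_ij`, so the double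
  -- sums need no case split.
  have hKB : ∀ i j, K i j + ‖secondFormVec X x (e i) (e j)‖ ^ 2
      = inner ℝ (secondFormVec X x (e j) (e j)) (secondFormVec X x (e i) (e i))
        + 1 - if i = j then 1 else 0 := by
    intro i j
    rw [hK]
    split_ifs with hij
    · rw [hij, real_inner_self_eq_norm_sq]; ring
    · rw [h.sectional_add_norm_sq hx he hij, sub_zero]
  have hHH : inner ℝ ((m : ℝ) • H) ((m : ℝ) • H) = (m : ℝ) * (m * ‖H‖ ^ 2) := by
    rw [real_inner_smul_left, real_inner_smul_right, real_inner_self_eq_norm_sq]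
  -- One factor of `⟨mH, mH⟩` is expanded without weights and the other with weights; in `q3` both
  -- are weighted.
  have q1 : ∑ i, ∑ j, a i * (inner ℝ (secondFormVec X x (e j) (e j))
      (secondFormVec X x (e i) (e i)) : ℝ) = m * (m * ‖H‖ ^ 2) := by
    rw [← hHH]
    nth_rewrite 1 [← hT]
    rw [← hA, Finset.sum_comm]
    simp only [sum_inner]
    simp only [inner_sum, real_inner_smul_right]
  have q2 : ∑ i, ∑ j, a j * (inner ℝ (secondFormVec X x (e j) (e j))
      (secondFormVec X x (e i) (e i)) : ℝ) = m * (m * ‖H‖ ^ 2) := by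
    rw [← q1, Finset.sum_comm]
    simp only [real_inner_comm]
  have q3 : ∑ i, ∑ j, a i * a j * (inner ℝ (secondFormVec X x (e j) (e j))
      (secondFormVec X x (e i) (e i)) : ℝ) = m * (m * ‖H‖ ^ 2) := by
    rw [← hHH, ← hA, Finset.sum_comm]
    simp only [sum_inner]
    simp only [inner_sum, real_inner_smul_left, real_inner_smul_right, mul_assoc,
      mul_left_comm]
  refine ⟨⟨s1, s1.symm.trans s2⟩, ?_, ?_⟩
  · simp only [hKB, mul_sub, mul_add, add_mul, Finset.sum_add_distrib, Finset.sum_sub_distrib,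
      q1, q2, mul_one, mul_ite, mul_zero, Finset.sum_ite_eq, Finset.mem_univ, if_true,
      Finset.sum_const, Finset.card_univ, Fintype.card_fin, nsmul_eq_mul]
    simp only [← Finset.mul_sum, ← s1]
    ring
  · simp only [hKB, mul_sub, mul_add, Finset.sum_add_distrib, Finset.sum_sub_distrib,
      q3, mul_one, mul_ite, mul_zero, Finset.sum_ite_eq, Finset.mem_univ, if_true,
      ← Finset.mul_sum, ← Finset.sum_mul]
    simp only [← sq, ← s1, ← s2]
    ring

end Identities

end IsLocalImmersion

/-! ### Expression of immersions in charts -/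

section Bridge

variable {m n : ℕ} {M : Type*} [TopologicalSpace M]
  [ChartedSpace (EuclideanSpace ℝ (Fin m)) M] [IsManifold (𝓡 m) ∞ M]
  {φ : M → Metric.sphere (0 : EuclideanSpace ℝ (Fin (n + 1))) 1}

theorem IsSmoothImmersion.isLocalImmersion (hφ : IsSmoothImmersion m φ) (p : M) :
    IsLocalImmersion (localRep m φ (chartAt (EuclideanSpace ℝ (Fin m)) p))
      (chartAt (EuclideanSpace ℝ (Fin m)) p).target := by
  set c := chartAt (EuclideanSpace ℝ (Fin m)) p with hc
  have hsm : ContMDiffOn (𝓡 m) (𝓡 m) ∞ c.symm c.target := contMDiffOn_chart_symm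
  have : Fact (Module.finrank ℝ (EuclideanSpace ℝ (Fin (n + 1))) = n + 1) :=
    ⟨finrank_euclideanSpace_fin⟩
  have hcoe : ContMDiff (𝓡 n) 𝓘(ℝ, EuclideanSpace ℝ (Fin (n + 1))) ∞
      (fun y : Metric.sphere (0 : EuclideanSpace ℝ (Fin (n + 1))) 1 =>
        (y : EuclideanSpace ℝ (Fin (n + 1)))) := contMDiff_coe_sphere
  refine ⟨c.open_target, ?_, ?_, ?_⟩
  · exact contMDiffOn_iff_contDiffOn.1 ((hcoe.comp hφ.1).comp_contMDiffOn hsm)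
  · intro x _
    have := (φ (c.symm x)).2
    rw [mem_sphere_zero_iff_norm] at this
    rw [localRep, real_inner_self_eq_norm_sq, this, one_pow]
  · intro x hx
    have hd1 : MDifferentiableAt (𝓡 m) (𝓡 m) c.symm x :=
      (mdifferentiable_chart p).symm.mdifferentiableAt hx
    have hd2 : MDifferentiableAt (𝓡 m) (𝓡 n) φ (c.symm x) :=
      (hφ.1 _).mdifferentiableAt (by simp)
    have hd3 := (hcoe (φ (c.symm x))).mdifferentiableAt (by simp)
    have h12 := mfderiv_comp x hd2 hd1
    have h123 := mfderiv_comp x hd3 (hd2.comp x hd1)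
    -- By the chain rule the derivative is a composite of three injective maps: those of the inverse
    -- chart, of `φ` and of the inclusion of the sphere.
    have hinj : Function.Injective (fderiv ℝ (localRep m φ c) x) := by
      rw [← mfderiv_eq_fderiv]
      have : mfderiv (𝓡 m) 𝓘(ℝ, EuclideanSpace ℝ (Fin (n + 1))) (localRep m φ c) x = _ := h123
      rw [this, h12]
      exact (injective_mvfderiv_subtypeVal_sphere _).comp
        ((hφ.2 _).comp ((mdifferentiable_chart p).symm.mfderiv_injective hx))
    have hb := (EuclideanSpace.basisFun (Fin m) ℝ).toBasis.linearIndependent.map'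
      (fderiv ℝ (localRep m φ c) x).toLinearMap (LinearMap.ker_eq_bot.2 hinj)
    have he : (fun i => pd i (localRep m φ c) x) = (fderiv ℝ (localRep m φ c) x).toLinearMap ∘
        (EuclideanSpace.basisFun (Fin m) ℝ).toBasis := by
      ext1 i
      simp [pd]
    rw [he]
    exact hb

end Bridge

end SphereSubmanifold

theorem mainTheorem3 {m n : ℕ} {M : Type*} [TopologicalSpace M]
    [ChartedSpace (EuclideanSpace ℝ (Fin m)) M] [IsManifold (𝓡 m) ∞ M]
    (φ : M → Metric.sphere (0 : EuclideanSpace ℝ (Fin (n + 1))) 1)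
    (hφ : SphereSubmanifold.IsSmoothImmersion m φ)
    (hbi : SphereSubmanifold.IsProperBiharmonic m φ)
    (hpar : SphereSubmanifold.HasParallelMeanCurvature m φ)
    (p : M) (e : Fin m → TangentSpace (𝓡 m) p) (a : Fin m → ℝ)
    (horth : ∀ i j, SphereSubmanifold.inducedMetricAt m φ p (e i) (e j) = if i = j then 1 else 0)
    (heig : ∀ i, SphereSubmanifold.weingartenAt m φ p (SphereSubmanifold.meanCurvatureAt m φ p) (e i)
      = a i • e i)
    (K : Fin m → Fin m → ℝ)
    (hK : ∀ i j, K i j = if i = j then 0 else SphereSubmanifold.sectionalAt m φ p (e i) (e j)) :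
    ((m : ℝ) * ‖SphereSubmanifold.meanCurvatureAt m φ p‖ ^ 2 = ∑ i, a i ∧
      ∑ i, a i = ∑ i, a i ^ 2) ∧
    (2 * (m : ℝ) - 1) * (m * ‖SphereSubmanifold.meanCurvatureAt m φ p‖ ^ 2)
      = (1 / 2) * ∑ i, ∑ j, (a i + a j) *
          (K i j + ‖SphereSubmanifold.secondFormAt m φ p (e i) (e j)‖ ^ 2) ∧
    ((m : ℝ) - 1 + m * ‖SphereSubmanifold.meanCurvatureAt m φ p‖ ^ 2) *
        (m * ‖SphereSubmanifold.meanCurvatureAt m φ p‖ ^ 2)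
      = ∑ i, ∑ j, a i * a j *
          (K i j + ‖SphereSubmanifold.secondFormAt m φ p (e i) (e j)‖ ^ 2) := by
  -- The objects at `p` are by definition those of the representation in the preferred chart.
  exact (hφ.isLocalImmersion p).curvature_identities (mem_chart_target _ p)
    (hbi.1 _ (chart_mem_atlas _ p) _ (mem_chart_target _ p)) (hpar _ (chart_mem_atlas _ p))
    horth heig K hK
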